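/- Work in the language $(\wedge,\vee,\to,0,1)$. Let $\mathsf{GA}$ be the variety of Gödel algebras, i.e. the variety generated by the totally ordered Heyting algebras. Gödel–Dummett logic is intuitionistic propositional logic extended by the axiom scheme $(\varphi\to\psi)\vee(\psi\to\varphi)$; its associated variety $\mathsf{V}_{GD}$ is the class of models of the equational theory $\{\varphi\approx\psi : {\vdash}\,\varphi\to\psi \text{ and } {\vdash}\,\psi\to\varphi\}$. Given a variety $\mathsf V$ with free algebras $\mathbf F_{\mathsf V}(X)$, a symbolic e-generalization problem is a finite nonempty multiset $\{t_1,\dots,t_m\}$ of terms, regarded as elements of $\mathbf F_{\mathsf V}(\omega)$. A solution is a term $s\in\mathbf F_{\mathsf V}(\omega)$ such that for each $k$ there is a substitution (endomorphism of $\mathbf F_{\mathsf V}(\omega)$) $\sigma_k$ with $\sigma_k(s)=t_k$. Solutions are preordered by $s\preceq u$ iff $s=\sigma(u)$ for some substitution $\sigma$. An algebraic e-generalization problem is a homomorphism $h:\mathbf F_{\mathsf V}(z)\to\prod_{k=1}^m\mathbf E_k$ with $m\ge1$, where each $\mathbf E_k\in\mathsf V$ is 1-generated and exact (isomorphic to a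 finitely generated subalgebra of a finitely generated free algebra of $\mathsf V$) and each component of $h$ is surjective. A solution is a homomorphism $g:\mathbf F_{\mathsf V}(z)\to\mathbf P$ with $\mathbf P$ finitely generated and projective in $\mathsf V$, such that $h=f\circ g$ for some homomorphism $f$. Solutions are preordered by $g\sqsubseteq g'$ iff $g=f\circ g'$ for some homomorphism $f$. In either setting, a minimal complete set of a poset is a subset $M$ of pairwise incomparable elements such that every element of the poset is above some element of $M$. A problem is unitary, finitary or infinitary if the poset of its solutions (modulo the equivalence induced by the preorder) has a minimal complete set that has exactly one element, is finite with more than one element, or is infinite, respectively; it is nullary if there is no minimal complete set. The symbolic (respectively algebraic) e-generalization type of $\mathsf V$ is the worst type occurring among its symbolic (respectively algebraic) problems, where unitary is better than finitary, finitary better than infinitary, and infinitary better than nullary. **Theorem.** The e-generalization type of Gödel–Dummett logic and of Gödel algebras is unitary: both the symbolic and the algebraic e-generalization types of $\mathsf V_{GD}$ and of $\mathsf{GA}$ are unitary. -/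

import Mathlib

universe u v

namespace EGen

open FirstOrder FirstOrder.Language

/-! ### Generalization types of posets -/

/-- The four generalization types. -/
inductive GenType
  | nullary
  | infinitary
  | finitary
  | unitary

/-- Rank of a generalization type, from the worst to the best. -/
def GenType.rank : GenType → ℕ
  | .nullary => 0
  | .infinitary => 1
  | .finitary => 2
  | .unitary => 3

theorem GenType.rank_injective : Function.Injective GenType.rank := by
  intro a b h
  cases a <;> cases b <;> simp [GenType.rank] at h ⊢

/-- Types are ordered from the worst (least) to the best (greatest):
nullary < infinitary < finitary < unitary. -/
instance : PartialOrder GenType := PartialOrder.lift GenType.rank GenType.rank_injective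

/-- `M` is a minimal complete set of the poset `P`: every element of `P` lies above some element
of `M`, and distinct elements of `M` are incomparable. -/
def IsMinimalCompleteSet {P : Type*} [PartialOrder P] (M : Set P) : Prop :=
  (∀ p : P, ∃ a ∈ M, a ≤ p) ∧ ∀ a ∈ M, ∀ b ∈ M, a ≠ b → ¬ a ≤ b ∧ ¬ b ≤ a

open Classical in
/-- The type of a (nonempty) poset, according to the cardinality of a minimal complete set. -/
noncomputable def posetType (P : Type*) [PartialOrder P] : GenType :=
  if ∃ M : Set P, IsMinimalCompleteSet M ∧ M.encard = 1 then .unitary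
  else if ∃ M : Set P, IsMinimalCompleteSet M ∧ M.Finite ∧ 1 < M.encard then .finitary
  else if ∃ M : Set P, IsMinimalCompleteSet M ∧ M.Infinite then .infinitary
  else .nullary

/-! ### Universal algebra -/

section UniversalAlgebra

variable {L : FirstOrder.Language.{0, 0}}

/-- The direct product of a family of structures. -/
instance piStructure {ι : Type*} {A : ι → Type*} [∀ i, L.Structure (A i)] :
    L.Structure (∀ i, A i) where
  funMap f x := fun i => Structure.funMap f fun k => x k i
  RelMap r x := ∀ i, Structure.RelMap r fun k => x k i

/-- A class of algebras of type `L`. -/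
abbrev AlgebraClass (L : FirstOrder.Language.{0, 0}) := ∀ (A : Type u) [L.Structure A], Prop

/-- A set of equations between `L`-terms, in countably many variables. -/
abbrev EquationalTheory (L : FirstOrder.Language.{0, 0}) := Set (L.Term ℕ × L.Term ℕ)

/-- `A` satisfies the equation `e`, under all assignments. -/
def Satisfies (A : Type u) [L.Structure A] (e : L.Term ℕ × L.Term ℕ) : Prop :=
  ∀ v : ℕ → A, e.1.realize v = e.2.realize v

/-- The variety axiomatized by an equational theory. -/
def varietyOf (Sig : EquationalTheory L) : AlgebraClass.{u} L :=
  fun A _ => ∀ e ∈ Sig, Satisfies A e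

/-- The equational theory of a class of algebras. -/
def theoryOf (K : AlgebraClass.{u} L) : EquationalTheory L :=
  {e | ∀ (A : Type u) [L.Structure A], K A → Satisfies A e}

/-- The variety generated by a class of algebras, i.e. the smallest variety containing it. -/
def generatedVariety (K : AlgebraClass.{u} L) : AlgebraClass.{u} L :=
  varietyOf (theoryOf K)

section Free

variable (V : AlgebraClass.{u} L) (X : Type v)

/-- Two terms are identified when they take the same value in every algebra of `V`, under every
assignment of the variables. -/
def freeSetoid : Setoid (L.Term X) where
  r s t := ∀ (A : Type u) [L.Structure A], V A → ∀ w : X → A, s.realize w = t.realize w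
  iseqv :=
    { refl := fun _ _ _ _ _ => rfl
      symm := fun h A _ hA w => (h A hA w).symm
      trans := fun h k A _ hA w => (h A hA w).trans (k A hA w) }

/-- The structure of the absolutely free algebra of terms is compatible with `freeSetoid`. -/
instance freePrestructure [L.IsAlgebraic] : L.Prestructure (freeSetoid V X) where
  toStructure :=
    { funMap := fun f ts => Term.func f ts
      RelMap := fun r => isEmptyElim r }
  fun_equiv := by
    intro n f x y h A _ hA w
    change (Term.func f x).realize w = (Term.func f y).realize w
    simp only [Term.realize_func]
    exact congrArg _ (funext fun i => h i A hA w)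
  rel_equiv := by
    intro n r
    exact isEmptyElim r

/-- The free algebra `F_V(X)`: terms over `X` modulo the equations valid in `V`. -/
def FreeAlg : Type v := Quotient (freeSetoid V X)

instance [L.IsAlgebraic] : L.Structure (FreeAlg V X) :=
  inferInstanceAs (L.Structure (Quotient (freeSetoid V X)))

end Free

variable [L.IsAlgebraic] (V : AlgebraClass.{u} L)

/-- `P` is projective in the class `V`. -/
def IsProjective (P : Type u) [L.Structure P] : Prop :=
  V P ∧ ∀ (A B : Type u) [L.Structure A] [L.Structure B], V A → V B →
    ∀ (h : P →[L] B) (g : A →[L] B), Function.Surjective g → ∃ f : P →[L] A, g.comp f = h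

/-- `E` is exact in `V`: it is isomorphic to a finitely generated subalgebra of a finitely
generated free algebra. -/
def IsExact (E : Type u) [L.Structure E] : Prop :=
  V E ∧ ∃ (X : Type u) (_ : Finite X) (S : L.Substructure (FreeAlg V X)),
    S.FG ∧ Nonempty (E ≃[L] S)

/-- `E` is generated by one element. -/
def IsOneGenerated (L : FirstOrder.Language.{0, 0}) (E : Type u) [L.Structure E] : Prop :=
  ∃ a : E, Substructure.closure L {a} = ⊤

/-! ### Symbolic e-generalization -/

/-- A symbolic e-generalization problem: a finite nonempty multiset of terms. Terms are elements of
the free algebra over countably many variables; finitely many of them involve only finitely many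
variables. -/
abbrev SymProblem := {t : Multiset (FreeAlg V ℕ) // t ≠ 0}

/-- The solutions of a symbolic problem: the terms `s` each of whose problem terms is of the
form `σ s`, for some substitution `σ`, i.e. some endomorphism of the free algebra over countably
many variables. -/
def SymSolution (t : SymProblem V) : Type :=
  {s : FreeAlg V ℕ // ∀ a ∈ t.1, ∃ σ : FreeAlg V ℕ →[L] FreeAlg V ℕ, σ s = a}

/-- `s ≤ u` (`s` is less general than `u`) when `s = σ u` for some substitution `σ`. -/
instance (t : SymProblem V) : Preorder (SymSolution V t) where
  le s u := ∃ σ : FreeAlg V ℕ →[L] FreeAlg V ℕ, σ u.1 = s.1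
  le_refl s := ⟨Hom.id L _, rfl⟩
  le_trans := by
    rintro s u w ⟨σ, hσ⟩ ⟨τ, hτ⟩
    exact ⟨σ.comp τ, by rw [Hom.comp_apply, hτ, hσ]⟩

/-- The type of a symbolic problem: the type of the poset of its solutions, modulo being equally
general. -/
noncomputable def symProblemType (t : SymProblem V) : GenType :=
  posetType (Antisymmetrization (SymSolution V t) (· ≤ ·))

/-- The symbolic e-generalization type of `V` is `τ`: the worst type of a symbolic problem. -/
def HasSymbolicType (τ : GenType) : Prop :=
  IsLeast (Set.range (symProblemType V)) τ

/-! ### Algebraic e-generalization -/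

/-- An algebraic e-generalization problem: a homomorphism from the free algebra on one generator
to a finite nonempty product of 1-generated exact algebras, whose components are surjective. -/
structure AlgProblem where
  m : ℕ
  one_le : 1 ≤ m
  E : Fin m → Type u
  [str : ∀ k, L.Structure (E k)]
  exact : ∀ k, IsExact V (E k)
  oneGenerated : ∀ k, IsOneGenerated L (E k)
  h : FreeAlg V PUnit.{u + 1} →[L] (∀ k, E k)
  surjective : ∀ k, Function.Surjective fun x => h x k

attribute [instance] AlgProblem.str

/-- A solution of an algebraic problem `h`: a homomorphism `g` from the free algebra on one
generator to a finitely generated projective algebra, such that `h` factors through `g`. -/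
structure AlgSolution (H : AlgProblem V) where
  P : Type u
  [str : L.Structure P]
  fg : Structure.FG L P
  projective : IsProjective V P
  g : FreeAlg V PUnit.{u + 1} →[L] P
  witness : ∃ f : P →[L] (∀ k, H.E k), f.comp g = H.h

attribute [instance] AlgSolution.str

/-- `s ≤ s'` (`s` is less general than `s'`) when `s` factors through `s'`. -/
instance (H : AlgProblem V) : Preorder (AlgSolution V H) where
  le s s' := ∃ f : s'.P →[L] s.P, f.comp s'.g = s.g
  le_refl s := ⟨Hom.id L _, by ext; rfl⟩
  le_trans := by
    rintro a b c ⟨f, hf⟩ ⟨k, hk⟩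
    exact ⟨f.comp k, by rw [Hom.comp_assoc, hk, hf]⟩

/-- The type of an algebraic problem: the type of the poset of its solutions, modulo being equally
general. -/
noncomputable def algProblemType (H : AlgProblem V) : GenType :=
  posetType (Antisymmetrization (AlgSolution V H) (· ≤ ·))

/-- The algebraic e-generalization type of `V` is `τ`: the worst type of an algebraic problem. -/
def HasAlgebraicType (τ : GenType) : Prop :=
  IsLeast (Set.range (algProblemType V)) τ

end UniversalAlgebra

/-! ### Gödel algebras -/

/-- The operation symbols `∧, ∨, →, 0, 1`, by arity. -/
inductive GodelFunc : ℕ → Type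
  | and : GodelFunc 2
  | or : GodelFunc 2
  | imp : GodelFunc 2
  | zero : GodelFunc 0
  | one : GodelFunc 0

/-- The language `(∧, ∨, →, 0, 1)`. -/
def godelLang : FirstOrder.Language.{0, 0} := ⟨GodelFunc, fun _ => Empty⟩

instance : godelLang.IsAlgebraic := fun _ => inferInstanceAs (IsEmpty Empty)

/-- A Heyting algebra as an algebra of type `(∧, ∨, →, 0, 1)`. -/
abbrev heytingStructure (A : Type u) [HeytingAlgebra A] : godelLang.Structure A where
  funMap {_} f :=
    match f with
    | .and => fun x => x 0 ⊓ x 1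
    | .or => fun x => x 0 ⊔ x 1
    | .imp => fun x => x 0 ⇨ x 1
    | .zero => fun _ => ⊥
    | .one => fun _ => ⊤
  RelMap {_} r := isEmptyElim (α := Empty) r

/-- The totally ordered Heyting algebras. -/
def HeytingChains : AlgebraClass.{u} godelLang :=
  fun A S => ∃ H : HeytingAlgebra A, (∀ a b : A, a ≤ b ∨ b ≤ a) ∧ S = heytingStructure A

/-- The variety of Gödel algebras: the variety generated by the totally ordered Heyting algebras. -/
def GodelAlgebras : AlgebraClass.{u} godelLang := generatedVariety HeytingChains

/-! ### Gödel–Dummett logic -/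

/-- Formulas: terms of the language, over countably many propositional variables. -/
abbrev GodelFormula := godelLang.Term ℕ

namespace GodelFormula

def and (p q : GodelFormula) : GodelFormula := Term.func (GodelFunc.and : godelLang.Functions 2) ![p, q]
def or (p q : GodelFormula) : GodelFormula := Term.func (GodelFunc.or : godelLang.Functions 2) ![p, q]
def imp (p q : GodelFormula) : GodelFormula := Term.func (GodelFunc.imp : godelLang.Functions 2) ![p, q]
def zero : GodelFormula := Term.func (GodelFunc.zero : godelLang.Functions 0) ![]
def one : GodelFormula := Term.func (GodelFunc.one : godelLang.Functions 0) ![]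

end GodelFormula

open GodelFormula in
/-- The consequence relation of Gödel–Dummett logic: a Hilbert calculus for intuitionistic
propositional logic together with the prelinearity axiom `(p → q) ∨ (q → p)`. -/
inductive Derives (Gam : Set GodelFormula) : GodelFormula → Prop
  | hyp {p} : p ∈ Gam → Derives Gam p
  | mp {p q} : Derives Gam (imp p q) → Derives Gam p → Derives Gam q
  | ax_k (p q) : Derives Gam (imp p (imp q p))
  | ax_s (p q r) : Derives Gam (imp (imp p (imp q r)) (imp (imp p q) (imp p r)))
  | and_left (p q) : Derives Gam (imp (and p q) p)
  | and_right (p q) : Derives Gam (imp (and p q) q)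
  | and_intro (p q) : Derives Gam (imp p (imp q (and p q)))
  | or_left (p q) : Derives Gam (imp p (or p q))
  | or_right (p q) : Derives Gam (imp q (or p q))
  | or_elim (p q r) : Derives Gam (imp (imp p r) (imp (imp q r) (imp (or p q) r)))
  | ex_falso (p) : Derives Gam (imp zero p)
  | truth : Derives Gam one
  | prelinearity (p q) : Derives Gam (or (imp p q) (imp q p))

/-- Logical equivalence in Gödel–Dummett logic, as an equational theory: the pairs of formulas each
of which provably implies the other. -/
def logicalEquivalence : EquationalTheory godelLang :=
  {e | Derives ∅ (GodelFormula.imp e.1 e.2) ∧ Derives ∅ (GodelFormula.imp e.2 e.1)}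

/-- The class of models of the equational theory of logical equivalence in Gödel–Dummett logic. -/
def GodelDummettVariety : AlgebraClass.{u} godelLang := varietyOf logicalEquivalence

end EGen

-- Two facts about Gödel algebras give the result: finitely generated ones are finite
-- (`finite_closure`), and finite nontrivial ones are projective (`isProjective_of_finite`).
-- Together they produce a least solution of every problem, and a least solution is by itself a
-- minimal complete set.
--
-- For an algebraic problem `h`, the product of the `E k` is finite and nontrivial, hence
-- projective, so `h` is a solution of its own problem. That a solution `g` satisfies `h = f ∘ g`
-- says exactly that `h` is below `g`.
--
-- For a symbolic problem, let `G` be the finite subalgebra of the free algebra `F` generated by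
-- finitely many variables sufficing for all the terms. The terms are the coordinates of one point
-- `p` of a finite power of `G`. This power is projective and an image of `F`, so it embeds in `F`
-- by a section `j`, and `j p` is the least solution.
--
-- Both facts rest on separation by chains (`eq_of_chain_hom`): an equality in a prelinear Heyting
-- algebra may be checked after every homomorphism to a chain. There `a ⇨ b` is `⊤` or `b`, so
-- finite generation leaves finitely many values, and a lift can be glued from two pieces, each
-- chain seeing only one of them.

universe w

namespace EGen

open FirstOrder FirstOrder.Language

/-! ### Posets with a least element -/

theorem posetType_of_isLeast {α : Type*} [Preorder α] (s : α) (hs : ∀ a, s ≤ a) :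
    posetType (Antisymmetrization α (· ≤ ·)) = .unitary := by
  refine if_pos ⟨{toAntisymmetrization (· ≤ ·) s}, ⟨fun p => ⟨_, rfl, ?_⟩, ?_⟩,
    Set.encard_singleton _⟩
  · induction p using Antisymmetrization.ind with
    | _ a => exact toAntisymmetrization_le_toAntisymmetrization_iff.2 (hs a)
  · rintro a rfl b rfl h
    exact absurd rfl h

/-- Unitary is the best type, so it can be the worst one occurring only if no other occurs;
`Nonempty` ensures that it does occur. -/
theorem isLeast_range_unitary {α : Type*} [Nonempty α] {f : α → GenType}
    (hf : ∀ a, f a = .unitary) : IsLeast (Set.range f) .unitary := by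
  refine ⟨⟨Classical.arbitrary α, hf _⟩, ?_⟩
  rintro _ ⟨a, rfl⟩
  exact (hf a).ge

/-! ### Gödel–Dummett derivations -/

open GodelFormula

theorem Derives.imp_self {Gam : Set GodelFormula} (p : GodelFormula) : Derives Gam (imp p p) :=
  .mp (.mp (.ax_s p (imp p p) p) (.ax_k _ _)) (.ax_k _ _)

theorem Derives.deduction {Gam : Set GodelFormula} {p q : GodelFormula}
    (h : Derives (insert p Gam) q) : Derives Gam (imp p q) := by
  induction h with
  | hyp h =>
    rcases h with rfl | h
    · exact .imp_self _
    · exact .mp (.ax_k _ _) (.hyp h)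
  | mp _ _ ih₁ ih₂ => exact .mp (.mp (.ax_s _ _ _) ih₁) ih₂
  | ax_k p q => exact .mp (.ax_k _ _) (.ax_k p q)
  | ax_s p q r => exact .mp (.ax_k _ _) (.ax_s p q r)
  | and_left p q => exact .mp (.ax_k _ _) (.and_left p q)
  | and_right p q => exact .mp (.ax_k _ _) (.and_right p q)
  | and_intro p q => exact .mp (.ax_k _ _) (.and_intro p q)
  | or_left p q => exact .mp (.ax_k _ _) (.or_left p q)
  | or_right p q => exact .mp (.ax_k _ _) (.or_right p q)
  | or_elim p q r => exact .mp (.ax_k _ _) (.or_elim p q r)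
  | ex_falso p => exact .mp (.ax_k _ _) (.ex_falso p)
  | truth => exact .mp (.ax_k _ _) .truth
  | prelinearity p q => exact .mp (.ax_k _ _) (.prelinearity p q)

theorem equiv_one_of_derives {p : GodelFormula} (h : Derives ∅ p) :
    (p, one) ∈ logicalEquivalence :=
  ⟨.mp (.ax_k _ _) .truth, .mp (.ax_k _ _) h⟩

theorem one_imp_equiv (p : GodelFormula) : (imp one p, p) ∈ logicalEquivalence :=
  ⟨.deduction (.mp (.hyp (by simp)) .truth), .ax_k _ _⟩

/-- This equation makes the order on a model antisymmetric: when `p → q` and `q → p` both take the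
value 1, its two sides reduce to the values of `p` and `q`. -/
theorem exchange_equiv (p q : GodelFormula) :
    (imp (imp p q) (imp (imp q p) p), imp (imp q p) (imp (imp p q) q)) ∈ logicalEquivalence := by
  have key : ∀ p q : GodelFormula, Derives ∅
      (imp (imp (imp p q) (imp (imp q p) p)) (imp (imp q p) (imp (imp p q) q))) := fun p q =>
    .deduction <| .deduction <| .deduction <|
      .mp (p := p) (.hyp (by simp)) <|
        .mp (p := imp q p) (.mp (p := imp p q) (.hyp (by simp)) (.hyp (by simp))) (.hyp (by simp))
  exact ⟨key p q, key q p⟩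

/-! ### The operations of an algebra -/

section Operations

variable {A : Type w} [godelLang.Structure A]

def opAnd (a b : A) : A :=
  Structure.funMap (L := godelLang) (GodelFunc.and : godelLang.Functions 2) ![a, b]
def opOr (a b : A) : A :=
  Structure.funMap (L := godelLang) (GodelFunc.or : godelLang.Functions 2) ![a, b]
def opImp (a b : A) : A :=
  Structure.funMap (L := godelLang) (GodelFunc.imp : godelLang.Functions 2) ![a, b]
variable (A) in
def opZero : A := Structure.funMap (L := godelLang) (GodelFunc.zero : godelLang.Functions 0) ![]
variable (A) in
def opOne : A := Structure.funMap (L := godelLang) (GodelFunc.one : godelLang.Functions 0) ![]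

variable (v : ℕ → A) (p q : GodelFormula)

@[simp] theorem realize_and : (and p q).realize v = opAnd (p.realize v) (q.realize v) := by
  refine congrArg (Structure.funMap (L := godelLang) _) (funext fun i => ?_)
  fin_cases i <;> rfl

@[simp] theorem realize_or : (or p q).realize v = opOr (p.realize v) (q.realize v) := by
  refine congrArg (Structure.funMap (L := godelLang) _) (funext fun i => ?_)
  fin_cases i <;> rfl

@[simp] theorem realize_imp : (imp p q).realize v = opImp (p.realize v) (q.realize v) := by
  refine congrArg (Structure.funMap (L := godelLang) _) (funext fun i => ?_)
  fin_cases i <;> rfl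

@[simp] theorem realize_zero : zero.realize v = opZero A :=
  congrArg (Structure.funMap (L := godelLang) _) (Subsingleton.elim _ _)

@[simp] theorem realize_one : one.realize v = opOne A :=
  congrArg (Structure.funMap (L := godelLang) _) (Subsingleton.elim _ _)

end Operations

/-! ### Models of Gödel–Dummett logic are the prelinear Heyting algebras -/

section Models

variable {A : Type w} [godelLang.Structure A]

theorem realize_eq_one (hA : GodelDummettVariety A) {p : GodelFormula} (h : Derives ∅ p)
    (v : ℕ → A) : p.realize v = opOne A := by
  simpa using hA _ (equiv_one_of_derives h) v

/-- The assignment of three values to the first three variables. -/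
def assign (a b c : A) : ℕ → A
  | 0 => a
  | 1 => b
  | _ => c

theorem opOne_opImp (hA : GodelDummettVariety A) (a : A) : opImp (opOne A) a = a := by
  simpa using hA _ (one_imp_equiv (.var 0)) fun _ => a

theorem eq_one_of_opImp (hA : GodelDummettVariety A) {a b : A} (h : opImp a b = opOne A)
    (ha : a = opOne A) : b = opOne A := by
  rw [ha, opOne_opImp hA] at h
  exact h

theorem opImp_const (hA : GodelDummettVariety A) (a b : A) :
    opImp a (opImp b a) = opOne A := by
  simpa [assign] using realize_eq_one hA (.ax_k (.var 0) (.var 1)) (assign a b b)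

theorem opImp_distrib (hA : GodelDummettVariety A) (a b c : A) :
    opImp (opImp a (opImp b c)) (opImp (opImp a b) (opImp a c)) = opOne A := by
  simpa [assign] using realize_eq_one hA (.ax_s (.var 0) (.var 1) (.var 2)) (assign a b c)

theorem opImp_const_of_eq_one (hA : GodelDummettVariety A) {b : A} (a : A) (h : b = opOne A) :
    opImp a b = opOne A :=
  eq_one_of_opImp hA (opImp_const hA b a) h

theorem opImp_mp (hA : GodelDummettVariety A) {a b c : A} (h : opImp a (opImp b c) = opOne A)
    (h' : opImp a b = opOne A) : opImp a c = opOne A :=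
  eq_one_of_opImp hA (eq_one_of_opImp hA (opImp_distrib hA a b c) h) h'

theorem opImp_trans (hA : GodelDummettVariety A) {a b c : A} (h : opImp a b = opOne A)
    (h' : opImp b c = opOne A) : opImp a c = opOne A :=
  opImp_mp hA (opImp_const_of_eq_one hA a h') h

theorem opImp_antisymm (hA : GodelDummettVariety A) {a b : A} (h : opImp a b = opOne A)
    (h' : opImp b a = opOne A) : a = b := by
  simpa [assign, h, h', opOne_opImp hA] using
    hA _ (exchange_equiv (.var 0) (.var 1)) (assign a b b)

theorem opAnd_left (hA : GodelDummettVariety A) (a b : A) : opImp (opAnd a b) a = opOne A := by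
  simpa [assign] using realize_eq_one hA (.and_left (.var 0) (.var 1)) (assign a b b)

theorem opAnd_right (hA : GodelDummettVariety A) (a b : A) : opImp (opAnd a b) b = opOne A := by
  simpa [assign] using realize_eq_one hA (.and_right (.var 0) (.var 1)) (assign a b b)

theorem opAnd_intro (hA : GodelDummettVariety A) (a b : A) :
    opImp a (opImp b (opAnd a b)) = opOne A := by
  simpa [assign] using realize_eq_one hA (.and_intro (.var 0) (.var 1)) (assign a b b)

theorem opOr_left (hA : GodelDummettVariety A) (a b : A) : opImp a (opOr a b) = opOne A := by
  simpa [assign] using realize_eq_one hA (.or_left (.var 0) (.var 1)) (assign a b b)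

theorem opOr_right (hA : GodelDummettVariety A) (a b : A) : opImp b (opOr a b) = opOne A := by
  simpa [assign] using realize_eq_one hA (.or_right (.var 0) (.var 1)) (assign a b b)

theorem opOr_elim (hA : GodelDummettVariety A) (a b c : A) :
    opImp (opImp a c) (opImp (opImp b c) (opImp (opOr a b) c)) = opOne A := by
  simpa [assign] using realize_eq_one hA (.or_elim (.var 0) (.var 1) (.var 2)) (assign a b c)

theorem opZero_opImp (hA : GodelDummettVariety A) (a : A) : opImp (opZero A) a = opOne A := by
  simpa [assign] using realize_eq_one hA (.ex_falso (.var 0)) (assign a a a)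

theorem opImp_prelinear (hA : GodelDummettVariety A) (a b : A) :
    opOr (opImp a b) (opImp b a) = opOne A := by
  simpa [assign] using realize_eq_one hA (.prelinearity (.var 0) (.var 1)) (assign a b b)

theorem opImp_refl (hA : GodelDummettVariety A) (a : A) : opImp a a = opOne A := by
  simpa [assign] using realize_eq_one hA (.imp_self (.var 0)) (assign a a a)

/-- A model of Gödel–Dummett logic is a Heyting algebra, for the order `a → b = 1`. -/
abbrev heytingOfModel (hA : GodelDummettVariety A) : HeytingAlgebra A where
  le a b := opImp a b = opOne A
  le_refl := opImp_refl hA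
  le_trans _ _ _ := opImp_trans hA
  le_antisymm _ _ := opImp_antisymm hA
  inf := opAnd
  inf_le_left := opAnd_left hA
  inf_le_right := opAnd_right hA
  le_inf a b c h h' := opImp_mp hA (opImp_trans hA h (opAnd_intro hA b c)) h'
  sup := opOr
  le_sup_left := opOr_left hA
  le_sup_right := opOr_right hA
  sup_le a b c h h' := eq_one_of_opImp hA (eq_one_of_opImp hA (opOr_elim hA a b c) h) h'
  top := opOne A
  le_top a := opImp_const_of_eq_one hA a rfl
  bot := opZero A
  bot_le := opZero_opImp hA
  himp := opImp
  compl a := opImp a (opZero A)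
  himp_bot _ := rfl
  le_himp_iff a b c :=
    ⟨fun h => opImp_mp hA (opImp_trans hA (opAnd_left hA a b) h) (opAnd_right hA a b),
      fun h => opImp_trans hA (opAnd_intro hA a b) <|
        eq_one_of_opImp hA (opImp_distrib hA b (opAnd a b) c) (opImp_const_of_eq_one hA b h)⟩

end Models

theorem structure_eq {A : Type w} {S T : godelLang.Structure A}
    (hand : ∀ a b : A, @opAnd A S a b = @opAnd A T a b)
    (hor : ∀ a b : A, @opOr A S a b = @opOr A T a b)
    (himp : ∀ a b : A, @opImp A S a b = @opImp A T a b)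
    (hzero : @opZero A S = @opZero A T) (hone : @opOne A S = @opOne A T) : S = T := by
  have two : ∀ x : Fin 2 → A, x = ![x 0, x 1] := fun x => by ext i; fin_cases i <;> rfl
  have none : ∀ x : Fin 0 → A, x = ![] := fun x => Subsingleton.elim _ _
  apply Structure.ext
  · funext n f x
    cases f with
    | and => rw [two x]; exact hand (x 0) (x 1)
    | or => rw [two x]; exact hor (x 0) (x 1)
    | imp => rw [two x]; exact himp (x 0) (x 1)
    | zero => rw [none x]; exact hzero
    | one => rw [none x]; exact hone
  · funext n r
    exact isEmptyElim r

/-- A Heyting algebra is prelinear when `(a ⇨ b) ⊔ (b ⇨ a) = ⊤` for all `a`, `b`. -/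
def Prelinear (A : Type w) [HeytingAlgebra A] : Prop :=
  ∀ a b : A, (a ⇨ b) ⊔ (b ⇨ a) = ⊤

theorem Prelinear.of_total {A : Type w} [HeytingAlgebra A] (h : ∀ a b : A, a ≤ b ∨ b ≤ a) :
    Prelinear A := fun a b => by
  rcases h a b with h | h <;> simp [himp_eq_top_iff.2 h]

theorem realize_eq_top_of_derives {A : Type w} [HeytingAlgebra A] (hA : Prelinear A)
    {Gam : Set GodelFormula} {p : GodelFormula} (h : Derives Gam p) (v : ℕ → A) :
    letI := heytingStructure A
    (∀ q ∈ Gam, q.realize v = (⊤ : A)) → p.realize v = (⊤ : A) := by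
  let := heytingStructure A
  intro hGam
  have hand : ∀ a b : A, opAnd a b = a ⊓ b := fun _ _ => rfl
  have hor : ∀ a b : A, opOr a b = a ⊔ b := fun _ _ => rfl
  have himp : ∀ a b : A, opImp a b = a ⇨ b := fun _ _ => rfl
  have hzero : opZero A = ⊥ := rfl
  have hone : opOne A = ⊤ := rfl
  induction h with
  | hyp h => exact hGam _ h
  | mp _ _ ih₁ ih₂ => simpa [himp, ih₂] using ih₁
  | ax_k p q => simp [himp]
  | ax_s p q r =>
    simp only [himp, realize_imp, himp_eq_top_iff, le_himp_iff]
    generalize p.realize v = a, q.realize v = b, r.realize v = c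
    have h₁ : (a ⇨ b ⇨ c) ⊓ (a ⇨ b) ⊓ a ≤ b := le_himp_iff.1 inf_le_right
    have h₂ : (a ⇨ b ⇨ c) ⊓ (a ⇨ b) ⊓ a ≤ b ⇨ c :=
      le_himp_iff.1 inf_le_left
    exact (le_inf h₂ h₁).trans himp_inf_le
  | and_left p q => simp [himp, hand]
  | and_right p q => simp [himp, hand]
  | and_intro p q => simp [himp, hand]
  | or_left p q => simp [himp, hor]
  | or_right p q => simp [himp, hor]
  | or_elim p q r => simp [himp, hor, sup_himp_distrib]
  | ex_falso p => simp [himp, hzero]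
  | truth => simpa using hone
  | prelinearity p q => simpa [himp, hor] using hA _ _

theorem model_heyting {A : Type w} [HeytingAlgebra A] (hA : Prelinear A) :
    @GodelDummettVariety A (heytingStructure A) := by
  let := heytingStructure A
  intro e he v
  have h₁ := realize_eq_top_of_derives hA he.1 v (by simp)
  have h₂ := realize_eq_top_of_derives hA he.2 v (by simp)
  rw [realize_imp] at h₁ h₂
  exact le_antisymm (himp_eq_top_iff.1 h₁) (himp_eq_top_iff.1 h₂)

theorem model_iff {A : Type w} [S : godelLang.Structure A] :
    GodelDummettVariety A ↔
      ∃ _ : HeytingAlgebra A, Prelinear A ∧ S = heytingStructure A := by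
  constructor
  · intro hA
    refine ⟨heytingOfModel hA, opImp_prelinear hA, ?_⟩
    exact structure_eq (fun _ _ => rfl) (fun _ _ => rfl) (fun _ _ => rfl) rfl rfl
  · rintro ⟨H, hA, rfl⟩
    exact model_heyting hA

theorem exists_partialOrder_quotient {α : Type w} [Preorder α] :
    ∃ (C : Type w) (_ : PartialOrder C) (π : α → C),
      Function.Surjective π ∧ ∀ x y, π x ≤ π y ↔ x ≤ y :=
  ⟨Antisymmetrization α (· ≤ ·), inferInstance, toAntisymmetrization (· ≤ ·),
    Quotient.mk_surjective, fun _ _ => Iff.rfl⟩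

/-! ### Separation by homomorphisms to chains -/

section Chains

variable {A : Type w} [HeytingAlgebra A]

/-- A prime filter of a Heyting algebra. -/
structure IsPrimeFilter (F : Set A) : Prop where
  top_mem : ⊤ ∈ F
  mem_of_le {a b : A} : a ≤ b → a ∈ F → b ∈ F
  inf_mem {a b : A} : a ∈ F → b ∈ F → a ⊓ b ∈ F
  mem_or_mem {a b : A} : a ⊔ b ∈ F → a ∈ F ∨ b ∈ F
  bot_notMem : ⊥ ∉ F

/-- The complement of a prime ideal that contains `b` and is disjoint from the principal filter of
`a`. -/
theorem exists_primeFilter {a b : A} (h : ¬ a ≤ b) :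
    ∃ F : Set A, IsPrimeFilter F ∧ a ∈ F ∧ b ∉ F := by
  obtain ⟨J, hJ, hbJ, hd⟩ := DistribLattice.prime_ideal_of_disjoint_filter_ideal
    (F := Order.PFilter.principal a) (I := Order.Ideal.principal b) (by
      rw [Set.disjoint_left]
      intro x hx hx'
      exact h ((Order.PFilter.mem_principal.1 hx).trans (Order.Ideal.mem_principal.1 hx')))
  refine ⟨(J : Set A)ᶜ, ⟨?_, ?_, ?_, ?_, ?_⟩, ?_, ?_⟩
  · exact hJ.toIsProper.top_notMem
  · exact fun hab ha hb => ha (J.lower hab hb)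
  · exact fun ha hb hab => (hJ.mem_or_mem hab).elim ha hb
  · intro a b hab
    by_contra! hn
    simp only [Set.mem_compl_iff, not_not] at hn
    exact hab (Order.Ideal.sup_mem hn.1 hn.2)
  · exact fun h => h J.bot_mem
  · exact fun ha => Set.disjoint_left.1 hd (Order.PFilter.mem_principal.2 le_rfl) ha
  · exact fun hb => hb (hbJ (Order.Ideal.mem_principal.2 le_rfl))

namespace IsPrimeFilter

variable {F : Set A}

theorem mp (hF : IsPrimeFilter F) {a b : A} (h : a ⇨ b ∈ F) (ha : a ∈ F) : b ∈ F :=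
  hF.mem_of_le himp_inf_le (hF.inf_mem h ha)

theorem himp_mem_of_le (hF : IsPrimeFilter F) {a b : A} (h : a ≤ b) : a ⇨ b ∈ F := by
  rw [himp_eq_top_iff.2 h]
  exact hF.top_mem

theorem himp_total (hF : IsPrimeFilter F) (hA : Prelinear A) (a b : A) :
    a ⇨ b ∈ F ∨ b ⇨ a ∈ F :=
  hF.mem_or_mem (by rw [hA]; exact hF.top_mem)

/-- Comparison modulo a prime filter. -/
abbrev preorder (hF : IsPrimeFilter F) : Preorder A where
  le a b := a ⇨ b ∈ F
  lt a b := a ⇨ b ∈ F ∧ b ⇨ a ∉ F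
  le_refl a := hF.himp_mem_of_le le_rfl
  le_trans a b c h h' := hF.mem_of_le (le_himp_iff.1 himp_le_himp_himp_himp) (hF.inf_mem h' h)

end IsPrimeFilter

theorem himp_of_not_le_of_total (hA : ∀ a b : A, a ≤ b ∨ b ≤ a) {a b : A} (h : ¬ a ≤ b) :
    a ⇨ b = b := by
  refine le_antisymm ?_ le_himp
  rcases hA (a ⇨ b) a with h' | h'
  · have := himp_inf_le (a := a) (b := b)
    rwa [inf_eq_left.2 h'] at this
  · exact absurd (le_himp_iff'.1 h' |>.trans' (by simp)) h

/-- Divide by a prime filter containing `a` but not `b`. Primeness applied to `(x ⇨ y) ⊔ (y ⇨ x) =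
⊤` makes the quotient total. -/
theorem exists_chain_hom (hA : Prelinear A) {a b : A} (h : ¬ a ≤ b) :
    ∃ (C : Type w) (_ : HeytingAlgebra C) (f : HeytingHom A C),
      (∀ x y : C, x ≤ y ∨ y ≤ x) ∧ ¬ f a ≤ f b := by
  classical
  obtain ⟨F, hF, ha, hb⟩ := exists_primeFilter h
  obtain ⟨C, _, π, hπ, hle⟩ : ∃ (C : Type w) (_ : PartialOrder C) (π : A → C),
      Function.Surjective π ∧ ∀ x y, π x ≤ π y ↔ x ⇨ y ∈ F :=
    @exists_partialOrder_quotient A hF.preorder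
  have hmono {x y : A} (hxy : x ≤ y) : π x ≤ π y := (hle x y).2 (hF.himp_mem_of_le hxy)
  have htot (x y : C) : x ≤ y ∨ y ≤ x := by
    obtain ⟨x, rfl⟩ := hπ x
    obtain ⟨y, rfl⟩ := hπ y
    simpa [hle] using hF.himp_total hA x y
  let : LinearOrder C := { ‹PartialOrder C› with
    le_total := htot
    toDecidableLE := Classical.decRel _ }
  let : BoundedOrder C :=
    { top := π ⊤
      bot := π ⊥
      le_top := fun x => by obtain ⟨x, rfl⟩ := hπ x; exact hmono le_top
      bot_le := fun x => by obtain ⟨x, rfl⟩ := hπ x; exact hmono bot_le }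
  let : HeytingAlgebra C := (LinearOrder.toBiheytingAlgebra C).toHeytingAlgebra
  have hinf (x y : A) : π (x ⊓ y) = π x ⊓ π y := by
    refine le_antisymm (le_inf (hmono inf_le_left) (hmono inf_le_right)) ?_
    rcases htot (π x) (π y) with h | h
    · rw [inf_eq_left.2 h, hle, himp_inf_distrib, himp_self, top_inf_eq]
      exact (hle _ _).1 h
    · rw [inf_eq_right.2 h, hle, himp_inf_distrib, himp_self, inf_top_eq]
      exact (hle _ _).1 h
  have hsup (x y : A) : π (x ⊔ y) = π x ⊔ π y := by
    refine le_antisymm ?_ (sup_le (hmono le_sup_left) (hmono le_sup_right))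
    rcases htot (π x) (π y) with h | h
    · rw [sup_eq_right.2 h, hle]
      simpa using (hle _ _).1 h
    · rw [sup_eq_left.2 h, hle]
      simpa using (hle _ _).1 h
  have himp (x y : A) : π (x ⇨ y) = π x ⇨ π y := by
    by_cases hxy : π x ≤ π y
    · rw [himp_eq_top_iff.2 hxy]
      refine top_unique ((hle _ _).2 ?_)
      simpa using (hle x y).1 hxy
    · rw [himp_of_not_le_of_total htot hxy]
      refine le_antisymm ((hle _ _).2 ?_) (hmono le_himp)
      -- Since `x ⇨ (x ⇨ y) = x ⇨ y` is not in `F`, totality puts `(x ⇨ y) ⇨ x` in `F`; this element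
      -- lies below `(x ⇨ y) ⇨ y`.
      have h₁ := (hF.himp_total hA x (x ⇨ y)).resolve_left (by simpa [hle] using hxy)
      refine hF.mem_of_le (le_himp_iff.2 ?_) h₁
      exact (le_inf himp_inf_le inf_le_right).trans inf_himp_le
  refine ⟨C, inferInstance, ⟨⟨⟨π, hsup⟩, hinf⟩, rfl, himp⟩, htot, ?_⟩
  change ¬ π a ≤ π b
  rw [hle]
  exact fun hab => hb (hF.mp hab ha)

theorem eq_of_chain_hom (hA : Prelinear A) {a b : A}
    (h : ∀ (C : Type w) [HeytingAlgebra C] (f : HeytingHom A C),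
      (∀ x y : C, x ≤ y ∨ y ≤ x) → f a = f b) : a = b := by
  by_contra hab
  rcases not_and_or.1 (mt le_antisymm_iff.2 hab) with hn | hn
  · obtain ⟨C, _, f, hC, hf⟩ := exists_chain_hom hA hn
    exact hf (h C f hC).le
  · obtain ⟨C, _, f, hC, hf⟩ := exists_chain_hom hA hn
    exact hf (h C f hC).ge

end Chains

/-- A homomorphism of Heyting algebras, as a homomorphism of algebras of type `(∧, ∨, →, 0, 1)`. -/
def homOfOps {A : Type v} {B : Type w} [godelLang.Structure A] [godelLang.Structure B] (f : A → B)
    (hand : ∀ a b, f (opAnd a b) = opAnd (f a) (f b)) (hor : ∀ a b, f (opOr a b) = opOr (f a) (f b))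
    (himp : ∀ a b, f (opImp a b) = opImp (f a) (f b)) (hzero : f (opZero A) = opZero B)
    (hone : f (opOne A) = opOne B) : A →[godelLang] B where
  toFun := f
  map_fun' := by
    intro n g x
    have two (x : Fin 2 → A) (g) : f (Structure.funMap (L := godelLang) g ![x 0, x 1]) =
        Structure.funMap (L := godelLang) g ![f (x 0), f (x 1)] →
        f (Structure.funMap (L := godelLang) g x) = Structure.funMap (L := godelLang) g (f ∘ x) := by
      intro h
      convert h using 2
      · congr 1; ext i; fin_cases i <;> rfl
      · ext i; fin_cases i <;> rfl
    cases g with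
    | and => exact two x _ (hand _ _)
    | or => exact two x _ (hor _ _)
    | imp => exact two x _ (himp _ _)
    | zero => rw [Subsingleton.elim (f ∘ x) (![]), Subsingleton.elim x (![])]; exact hzero
    | one => rw [Subsingleton.elim (f ∘ x) (![]), Subsingleton.elim x (![])]; exact hone
  map_rel' := by
    intro n r
    exact isEmptyElim r

section Hom

variable {A : Type v} {B : Type w} [godelLang.Structure A] [godelLang.Structure B]

theorem hom_two (f : A →[godelLang] B) (g : godelLang.Functions 2) (a b : A) :
    f (Structure.funMap g ![a, b]) = Structure.funMap g ![f a, f b] := by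
  rw [f.map_fun]
  congr 1; ext i; fin_cases i <;> rfl

theorem hom_opAnd (f : A →[godelLang] B) (a b : A) : f (opAnd a b) = opAnd (f a) (f b) :=
  hom_two f _ a b

theorem hom_opOr (f : A →[godelLang] B) (a b : A) : f (opOr a b) = opOr (f a) (f b) :=
  hom_two f _ a b

theorem hom_opImp (f : A →[godelLang] B) (a b : A) : f (opImp a b) = opImp (f a) (f b) :=
  hom_two f _ a b

theorem hom_opZero (f : A →[godelLang] B) : f (opZero A) = opZero B :=
  (f.map_fun _ _).trans (congrArg _ (Subsingleton.elim _ _))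

theorem hom_opOne (f : A →[godelLang] B) : f (opOne A) = opOne B :=
  (f.map_fun _ _).trans (congrArg _ (Subsingleton.elim _ _))

end Hom

/-- A homomorphism of Heyting algebras is a homomorphism of algebras. -/
abbrev homOfHeytingHom {A : Type v} {B : Type w} [HeytingAlgebra A] [HeytingAlgebra B]
    (f : HeytingHom A B) :
    letI := heytingStructure A
    letI := heytingStructure B
    A →[godelLang] B :=
  letI := heytingStructure A
  letI := heytingStructure B
  homOfOps f (map_inf f) (map_sup f) (map_himp f) (map_bot f) (map_top f)

/-- Chains are prelinear, hence models of the logic. Conversely, an equation valid in all chains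
passes to every model, because homomorphisms to chains separate points. -/
theorem godelAlgebras_eq : GodelAlgebras.{u} = GodelDummettVariety.{u} := by
  funext A S
  refine propext ⟨fun hA e he => hA e fun C T hC => ?_, fun hA e he v => ?_⟩
  · obtain ⟨H, hC, rfl⟩ := hC
    exact model_heyting (.of_total hC) e he
  · obtain ⟨H, hP, rfl⟩ := model_iff.1 hA
    refine eq_of_chain_hom hP fun C _ f hC => ?_
    let := heytingStructure A
    let := heytingStructure C
    have h := he C ⟨inferInstance, hC, rfl⟩ (homOfHeytingHom f ∘ v)
    rwa [HomClass.realize_term, HomClass.realize_term] at h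

/-! ### Finite nontrivial Gödel algebras are projective -/

section Lifting

variable {P A B : Type w} [HeytingAlgebra P] [HeytingAlgebra A] [HeytingAlgebra B]

theorem himp_congr_of_inf_eq {a b c : A} (h : a ⊓ b = a ⊓ c) : a ⇨ b = a ⇨ c := by
  rw [← top_inf_eq (a ⇨ b), ← himp_self (a := a), ← himp_inf_distrib, h, himp_inf_distrib,
    himp_self, top_inf_eq]

theorem himp_himp_distrib (a b c : A) : a ⇨ b ⇨ c = (a ⇨ b) ⇨ a ⇨ c := by
  rw [himp_himp, himp_himp, inf_comm (a ⇨ b), inf_himp]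

/-- Not valid in all Heyting algebras. It is what makes `φ ⇨ ·` preserve joins in chains. -/
theorem himp_sup_of_total (hA : ∀ a b : A, a ≤ b ∨ b ≤ a) (a b c : A) :
    a ⇨ (b ⊔ c) = (a ⇨ b) ⊔ (a ⇨ c) := by
  rcases hA b c with h | h
  · rw [sup_eq_right.2 h, sup_eq_right.2 (himp_le_himp_left h)]
  · rw [sup_eq_left.2 h, sup_eq_left.2 (himp_le_himp_left h)]

theorem compl_eq_bot_of_total (hA : ∀ a b : A, a ≤ b ∨ b ≤ a) {a : A} (h : a ≠ ⊥) : aᶜ = ⊥ := by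
  rw [← himp_bot, himp_of_not_le_of_total hA (by simpa using h)]

/-- Finitely many identifications made by a homomorphism hold below a single element. -/
theorem exists_inf_eq {ι : Type*} [Finite ι] (g : HeytingHom A B) (s t : ι → A)
    (h : ∀ i, g (s i) = g (t i)) : ∃ φ : A, g φ = ⊤ ∧ ∀ ψ ≤ φ, ∀ i, ψ ⊓ s i = ψ ⊓ t i := by
  have := Fintype.ofFinite ι
  refine ⟨Finset.univ.inf fun i => (s i ⇨ t i) ⊓ (t i ⇨ s i), ?_, fun ψ hψ i => ?_⟩
  · rw [map_finset_inf, Finset.inf_eq_top_iff]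
    simp [h]
  · have hi := hψ.trans (Finset.inf_le (Finset.mem_univ i))
    refine le_antisymm (le_inf inf_le_left ?_) (le_inf inf_le_left ?_)
    · exact le_himp_iff.1 (hi.trans inf_le_left)
    · exact le_himp_iff.1 (hi.trans inf_le_right)

open Classical in
/-- The two-valued homomorphism given by an atom. -/
noncomputable def atomValue (A : Type w) [HeytingAlgebra A] (a x : P) : A :=
  if a ≤ x then ⊤ else ⊥

/-- A set-theoretic lift `c` of `h` respects the operations up to finitely many equations, all of
which hold below some `φ` with `g φ = ⊤`. Thus `φ ⇨ c x` behaves as a homomorphism wherever `φ` is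
nonzero. Where `φ` vanishes it is constantly `⊤`, and is replaced there by a two-valued homomorphism
of `P`. -/
theorem exists_lift [Finite P] [Nontrivial P] (hA : Prelinear A) (h : HeytingHom P B)
    (g : HeytingHom A B) (hg : Function.Surjective g) :
    ∃ f : HeytingHom P A, ∀ x, g (f x) = h x := by
  classical
  choose c hc using fun x => hg (h x)
  obtain ⟨φ₁, hφ₁, h₁⟩ := exists_inf_eq g (fun p : P × P => c (p.1 ⊓ p.2))
    (fun p => c p.1 ⊓ c p.2) (by simp [hc])
  obtain ⟨φ₂, hφ₂, h₂⟩ := exists_inf_eq g (fun p : P × P => c (p.1 ⊔ p.2))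
    (fun p => c p.1 ⊔ c p.2) (by simp [hc])
  obtain ⟨φ₃, hφ₃, h₃⟩ := exists_inf_eq g (fun p : P × P => c (p.1 ⇨ p.2))
    (fun p => c p.1 ⇨ c p.2) (by simp [hc])
  obtain ⟨φ₄, hφ₄, h₄⟩ := exists_inf_eq g (fun _ : Unit => c ⊥) (fun _ => ⊥) (by simp [hc])
  obtain ⟨φ, hφ, hinf, hsup, himp, hbot⟩ : ∃ φ : A, g φ = ⊤ ∧
      (∀ x y, φ ⇨ c (x ⊓ y) = φ ⇨ (c x ⊓ c y)) ∧ (∀ x y, φ ⇨ c (x ⊔ y) = φ ⇨ (c x ⊔ c y)) ∧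
      (∀ x y, φ ⇨ c (x ⇨ y) = φ ⇨ c x ⇨ c y) ∧ φ ⇨ c ⊥ = φ ⇨ ⊥ := by
    refine ⟨φ₁ ⊓ φ₂ ⊓ (φ₃ ⊓ φ₄), by simp [hφ₁, hφ₂, hφ₃, hφ₄],
      fun x y => himp_congr_of_inf_eq (h₁ _ ?_ (x, y)),
      fun x y => himp_congr_of_inf_eq (h₂ _ ?_ (x, y)),
      fun x y => himp_congr_of_inf_eq (h₃ _ ?_ (x, y)),
      himp_congr_of_inf_eq (h₄ _ ?_ ())⟩
    · exact inf_le_left.trans inf_le_left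
    · exact inf_le_left.trans inf_le_right
    · exact inf_le_right.trans inf_le_left
    · exact inf_le_right.trans inf_le_right
  obtain ⟨a, ha, -⟩ := (eq_bot_or_exists_atom_le (⊤ : P)).resolve_left top_ne_bot
  -- Definition by cases: in a chain, `φ = ⊥` kills the first factor's constraint and `φ ≠ ⊥` gives
  -- `φᶜ = ⊥`, which kills the second's. Under `g`, only the first remains.
  obtain ⟨f, hf⟩ : ∃ f : P → A, ∀ x, f x = (φ ⇨ c x) ⊓ (φᶜ ⇨ atomValue A a x) :=
    ⟨_, fun _ => rfl⟩
  have hvinf (x y : P) : atomValue A a (x ⊓ y) = atomValue A a x ⊓ atomValue A a y := by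
    by_cases hx : a ≤ x <;> by_cases hy : a ≤ y <;> simp [atomValue, hx, hy]
  have hvsup (x y : P) : atomValue A a (x ⊔ y) = atomValue A a x ⊔ atomValue A a y := by
    -- An atom is join-prime, by distributivity.
    have : a ≤ x ⊔ y ↔ a ≤ x ∨ a ≤ y := by
      refine ⟨fun hxy => ?_, fun hxy => hxy.elim (le_sup_of_le_left ·) (le_sup_of_le_right ·)⟩
      by_contra! hn
      refine ha.1 (disjoint_self.1 (Disjoint.mono_right hxy (disjoint_sup_right.2 ⟨?_, ?_⟩)))
      · exact ha.not_le_iff_disjoint.1 hn.1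
      · exact ha.not_le_iff_disjoint.1 hn.2
    by_cases hx : a ≤ x <;> by_cases hy : a ≤ y <;> simp [atomValue, this, hx, hy]
  have hvimp (x y : P) : atomValue A a (x ⇨ y) = atomValue A a x ⇨ atomValue A a y := by
    by_cases hx : a ≤ x
    · simp [atomValue, le_himp_iff, hx]
    · have : a ⊓ x = ⊥ := disjoint_iff.1 (ha.not_le_iff_disjoint.1 hx)
      simp [atomValue, le_himp_iff, this, hx]
  have hvbot : atomValue A a ⊥ = ⊥ := by simp [atomValue, ha.1]
  have hval (C : Type w) [HeytingAlgebra C] (π : HeytingHom A C) (hC : ∀ x y : C, x ≤ y ∨ y ≤ x) :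
      (∀ x, π (f x) = π (φ ⇨ c x)) ∧ π φ ≠ ⊥ ∨ ∀ x, π (f x) = π (atomValue A a x) := by
    by_cases hb : π φ = ⊥
    · exact .inr fun x => by simp [hf, hb]
    · exact .inl ⟨fun x => by simp [hf, compl_eq_bot_of_total hC hb], hb⟩
  refine ⟨⟨⟨⟨f, fun x y => ?_⟩, fun x y => ?_⟩, ?_, fun x y => ?_⟩, fun x => ?_⟩
  · refine eq_of_chain_hom hA fun C _ π hC => ?_
    rcases hval C π hC with ⟨hv, -⟩ | hv
    · rw [map_sup, hv, hv, hv, hsup, map_himp, map_sup, himp_sup_of_total hC, map_himp, map_himp]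
    · rw [map_sup, hv, hv, hv, hvsup, map_sup]
  · refine eq_of_chain_hom hA fun C _ π hC => ?_
    rcases hval C π hC with ⟨hv, -⟩ | hv
    · change π (f (x ⊓ y)) = π (f x ⊓ f y)
      rw [map_inf, hv, hv, hv, hinf, himp_inf_distrib, map_inf]
    · change π (f (x ⊓ y)) = π (f x ⊓ f y)
      rw [map_inf, hv, hv, hv, hvinf, map_inf]
  · refine eq_of_chain_hom hA fun C _ π hC => ?_
    change π (f ⊥) = π ⊥
    -- Here `π φ ≠ ⊥` is essential: otherwise `φ ⇨ ⊥` would be sent to `⊤`.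
    rcases hval C π hC with ⟨hv, hb⟩ | hv
    · rw [hv, hbot, himp_bot, map_compl, map_bot, compl_eq_bot_of_total hC hb]
    · rw [hv, hvbot]
  · refine eq_of_chain_hom hA fun C _ π hC => ?_
    change π (f (x ⇨ y)) = π (f x ⇨ f y)
    rcases hval C π hC with ⟨hv, -⟩ | hv
    · rw [map_himp, hv, hv, hv, himp, himp_himp_distrib, map_himp]
    · rw [map_himp, hv, hv, hv, hvimp, map_himp]
  · change g (f x) = h x
    simp [hf, hφ, hc]

end Lifting

/-- A homomorphism of algebras between Heyting algebras is a homomorphism of Heyting algebras. -/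
def heytingHomOfHom {A : Type v} {B : Type w} [HeytingAlgebra A] [HeytingAlgebra B]
    (f : @Hom godelLang A B (heytingStructure A) (heytingStructure B)) : HeytingHom A B :=
  letI := heytingStructure A
  letI := heytingStructure B
  { toFun := f
    map_sup' := hom_opOr f
    map_inf' := hom_opAnd f
    map_bot' := hom_opZero f
    map_himp' := hom_opImp f }

/-- Nontriviality cannot be dropped: an algebra with `0 = 1` has no homomorphism to one with `0 ≠
1`. -/
theorem isProjective_of_finite {P : Type u} [godelLang.Structure P] [Finite P] [Nontrivial P]
    (hP : GodelDummettVariety P) : IsProjective GodelDummettVariety.{u} P := by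
  refine ⟨hP, fun A B SA SB hA hB h g hg => ?_⟩
  obtain ⟨_, _, rfl⟩ := model_iff.1 hP
  obtain ⟨_, hA', rfl⟩ := model_iff.1 hA
  obtain ⟨_, _, rfl⟩ := model_iff.1 hB
  obtain ⟨f, hf⟩ := exists_lift hA' (heytingHomOfHom h) (heytingHomOfHom g) hg
  exact ⟨homOfHeytingHom f, DFunLike.ext _ _ hf⟩

/-! ### Finitely generated Gödel algebras are finite -/

section Finite

variable {A : Type w} [HeytingAlgebra A]

/-- `τ` computes the value of `a` in chains, from the order of the values of the elements of `S`. -/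
def Determines (S : Set A) (τ : (S → S → Prop) → S) (a : A) : Prop :=
  ∀ (C : Type w) [HeytingAlgebra C] (π : HeytingHom A C), (∀ x y : C, x ≤ y ∨ y ≤ x) →
    π a = π (τ fun s t => π s ≤ π t)

/-- In a chain, every operation returns an argument or a constant, and the choice depends only on
the order of the arguments. So each generated element is coded by a selector on the finitely many
order patterns of the generators and constants, and separation by chains makes the coding injective.
-/
theorem finite_closure_heyting (hA : Prelinear A) {S : Set A} (hS : S.Finite) :
    letI := heytingStructure A
    Finite (Substructure.closure godelLang S) := by
  classical
  let := heytingStructure A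
  let T : Set A := insert ⊥ (insert ⊤ S)
  have : Finite T := (hS.insert _).insert _
  have key : ∀ a ∈ Substructure.closure godelLang S, ∃ τ, Determines T τ a := by
    intro a ha
    refine Substructure.closure_induction (p := fun a => ∃ τ, Determines T τ a) ha
      (fun x hx => ⟨fun _ => ⟨x, .inr (.inr hx)⟩, fun _ _ _ _ => rfl⟩) fun f => ?_
    intro x hx
    choose τ hτ using hx
    cases f with
    | and =>
      refine ⟨fun d => if d (τ 0 d) (τ 1 d) then τ 0 d else τ 1 d, fun C _ π hC => ?_⟩
      change π (x 0 ⊓ x 1) = _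
      rw [map_inf, hτ 0 C π hC, hτ 1 C π hC]
      beta_reduce
      split_ifs with h
      · exact inf_eq_left.2 h
      · exact inf_eq_right.2 ((hC _ _).resolve_left h)
    | or =>
      refine ⟨fun d => if d (τ 0 d) (τ 1 d) then τ 1 d else τ 0 d, fun C _ π hC => ?_⟩
      change π (x 0 ⊔ x 1) = _
      rw [map_sup, hτ 0 C π hC, hτ 1 C π hC]
      beta_reduce
      split_ifs with h
      · exact sup_eq_right.2 h
      · exact sup_eq_left.2 ((hC _ _).resolve_left h)
    | imp =>
      refine ⟨fun d => if d (τ 0 d) (τ 1 d) then ⟨⊤, .inr (.inl rfl)⟩ else τ 1 d,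
        fun C _ π hC => ?_⟩
      change π (x 0 ⇨ x 1) = _
      rw [map_himp, hτ 0 C π hC, hτ 1 C π hC]
      beta_reduce
      split_ifs with h
      · rw [himp_eq_top_iff.2 h]
        exact (map_top π).symm
      · exact himp_of_not_le_of_total hC h
    | zero => exact ⟨fun _ => ⟨⊥, .inl rfl⟩, fun _ _ _ _ => rfl⟩
    | one => exact ⟨fun _ => ⟨⊤, .inr (.inl rfl)⟩, fun _ _ _ _ => rfl⟩
  choose τ hτ using fun a : Substructure.closure godelLang S => key a a.2
  refine Finite.of_injective τ fun a b hab => Subtype.ext ?_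
  refine eq_of_chain_hom hA fun C _ π hC => ?_
  rw [hτ a C π hC, hτ b C π hC, hab]

end Finite

theorem finite_closure {A : Type w} [godelLang.Structure A] (hA : GodelDummettVariety A)
    {S : Set A} (hS : S.Finite) : Finite (Substructure.closure godelLang S) := by
  obtain ⟨_, hA', rfl⟩ := model_iff.1 hA
  exact finite_closure_heyting hA' hS

/-! ### Closure properties of varieties, and free algebras -/

section UniversalAlgebra

variable {L : FirstOrder.Language.{0, 0}}

theorem varietyOf_of_injective {Sig : EquationalTheory L} {A : Type v} {B : Type w}
    [L.Structure A] [L.Structure B] (hB : varietyOf Sig B) (f : A →[L] B)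
    (hf : Function.Injective f) : varietyOf Sig A := fun e he v => hf <| by
  rw [← HomClass.realize_term, ← HomClass.realize_term]
  exact hB e he _

variable {V : AlgebraClass.{u} L} {X : Type v} {Y : Type w}

namespace FreeAlg

/-- The class of a term in the free algebra. -/
def mk (V : AlgebraClass.{u} L) (t : L.Term X) : FreeAlg V X := Quotient.mk (freeSetoid V X) t

theorem mk_surjective : Function.Surjective (mk V : L.Term X → FreeAlg V X) :=
  Quotient.mk_surjective

end FreeAlg

variable [L.IsAlgebraic]

/-- The projections of a direct product. -/
def evalHom {ι : Type v} (A : ι → Type w) [∀ i, L.Structure (A i)] (i : ι) :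
    (∀ i, A i) →[L] A i where
  toFun x := x i
  map_rel' r := isEmptyElim r

/-- The homomorphism to a direct product with given components. -/
def piHom {ι : Type*} {A : ι → Type*} [∀ i, L.Structure (A i)] {B : Type*} [L.Structure B]
    (f : ∀ i, B →[L] A i) : B →[L] ∀ i, A i where
  toFun b i := f i b
  map_fun' g x := funext fun i => (f i).map_fun g x
  map_rel' r := isEmptyElim r

theorem varietyOf_pi {Sig : EquationalTheory L} {ι : Type v} {A : ι → Type w}
    [∀ i, L.Structure (A i)] (h : ∀ i, varietyOf Sig (A i)) : varietyOf Sig (∀ i, A i) :=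
  fun e he v => funext fun i => by
    have := h i e he (evalHom (L := L) A i ∘ v)
    rwa [HomClass.realize_term, HomClass.realize_term] at this

namespace FreeAlg

/-- The generators of the free algebra. -/
def var (V : AlgebraClass.{u} L) (x : X) : FreeAlg V X := mk V (.var x)

theorem mk_func {n : ℕ} (f : L.Functions n) (ts : Fin n → L.Term X) :
    mk V (.func f ts) = Structure.funMap f fun i => mk V (ts i) :=
  (funMap_quotient_mk' (s := freeSetoid V X) (ps := freePrestructure V X) f ts).symm

theorem mk_subst (t : L.Term X) (w : X → L.Term Y) :
    mk V (t.subst w) = t.realize fun x => mk V (w x) := by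
  induction t with
  | var x => rfl
  | func f ts ih =>
    rw [Term.realize_func, Term.subst, mk_func]
    exact congrArg _ (funext ih)

/-- Obtained by substituting representative terms. Restricting to free targets leaves the universes
of `X`, `Y` and `V` independent. -/
theorem exists_hom (w : X → FreeAlg V Y) :
    ∃ f : FreeAlg V X →[L] FreeAlg V Y, ∀ x, f (var V x) = w x := by
  choose w' hw' using fun x => mk_surjective (w x)
  refine ⟨⟨Quotient.map (sa := freeSetoid V X) (sb := freeSetoid V Y) (·.subst w') ?_, ?_, ?_⟩, hw'⟩
  · intro s t h A _ hA v
    simpa only [Term.realize_subst] using h A hA _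
  · intro n f x
    choose t ht using fun i => mk_surjective (x i)
    obtain rfl : (fun i => mk V (t i)) = x := funext ht
    rw [← mk_func]
    exact mk_func f fun i => (t i).subst w'
  · intro n r
    exact isEmptyElim r

theorem varietyOf_freeAlg (Sig : EquationalTheory L) :
    varietyOf Sig (FreeAlg (varietyOf.{u} Sig) X) := by
  intro e he v
  choose w hw using fun i => mk_surjective (v i)
  obtain rfl : (fun i => mk _ (w i)) = v := funext hw
  rw [← mk_subst, ← mk_subst]
  refine Quotient.sound fun A _ hA v => ?_
  simpa only [Term.realize_subst] using hA e he _

theorem hom_mem {B : Type*} [L.Structure B] (f : FreeAlg V X →[L] B) (S : L.Substructure B)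
    (h : ∀ x, f (var V x) ∈ S) (a : FreeAlg V X) : f a ∈ S := by
  obtain ⟨t, rfl⟩ := mk_surjective a
  induction t with
  | var x => exact h x
  | func g ts ih =>
    rw [mk_func, f.map_fun]
    exact S.fun_mem g _ ih

theorem closure_var : Substructure.closure L (Set.range (var V : X → FreeAlg V X)) = ⊤ :=
  top_unique fun a _ => hom_mem (Hom.id L (FreeAlg V X))
    (Substructure.closure L (Set.range (var V))) (fun x => Substructure.subset_closure ⟨x, rfl⟩) a

/-- Each element of a free algebra involves finitely many generators only. -/
theorem exists_support (a : FreeAlg V ℕ) : ∃ n, ∀ f : FreeAlg V ℕ →[L] FreeAlg V ℕ,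
    (∀ i < n, f (var V i) = var V i) → f a = a := by
  obtain ⟨t, rfl⟩ := mk_surjective a
  induction t with
  | var x => exact ⟨x + 1, fun f hf => hf x x.lt_succ_self⟩
  | func g ts ih =>
    choose n hn using ih
    refine ⟨Finset.univ.sup n, fun f hf => ?_⟩
    rw [mk_func, f.map_fun]
    exact congrArg _ (funext fun i => hn i f fun j hj =>
      hf j (hj.trans_le (Finset.le_sup (Finset.mem_univ i))))

end FreeAlg

end UniversalAlgebra

/-! ### Generalization in Gödel algebras -/

open FreeAlg

/-- The two-element Boolean algebra, realized as `Set PUnit`, is a model with `0 ≠ 1`. -/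
theorem zero_ne_one_freeAlg (X : Type v) :
    opZero (FreeAlg GodelDummettVariety.{u} X) ≠ opOne (FreeAlg GodelDummettVariety.{u} X) := by
  intro h
  have hB : Prelinear (Set PUnit.{u + 1}) := fun a b => by
    ext x
    by_cases x ∈ a <;> by_cases x ∈ b <;> simp_all [himp_eq]
  have hz : mk GodelDummettVariety.{u} (.func (GodelFunc.zero : godelLang.Functions 0) ![]) =
      opZero (FreeAlg GodelDummettVariety.{u} X) :=
    (mk_func _ _).trans (congrArg _ (Subsingleton.elim _ _))
  have ho : mk GodelDummettVariety.{u} (.func (GodelFunc.one : godelLang.Functions 0) ![]) =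
      opOne (FreeAlg GodelDummettVariety.{u} X) :=
    (mk_func _ _).trans (congrArg _ (Subsingleton.elim _ _))
  have h' := @Quotient.exact _ (freeSetoid _ _) _ _ (hz.trans (h.trans ho.symm)) (Set PUnit.{u + 1})
    (heytingStructure _) (model_heyting hB) fun _ => ∅
  exact bot_ne_top (α := Set PUnit.{u + 1}) h'

theorem model_freeAlg (X : Type v) :
    GodelDummettVariety (FreeAlg GodelDummettVariety.{u} X) :=
  varietyOf_freeAlg _

theorem nontrivial_of_hom {A : Type v} {B : Type w} [godelLang.Structure A] [godelLang.Structure B]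
    (f : A →[godelLang] B) (h : opZero B ≠ opOne B) : Nontrivial A :=
  ⟨opZero A, opOne A, fun h' => h (by rw [← hom_opZero f, h', hom_opOne])⟩

theorem symProblemType_eq_unitary (t : SymProblem GodelDummettVariety.{u}) :
    symProblemType _ t = .unitary := by
  classical
  let F := FreeAlg GodelDummettVariety.{u} ℕ
  choose N hN using exists_support (V := GodelDummettVariety.{u})
  let n := t.1.toFinset.sup N
  -- `ρ` fixes the variables that the problem terms involve and sends the others to 0, so it fixes
  -- the terms and has a finitely generated image.
  obtain ⟨ρ, hρ⟩ := exists_hom (V := GodelDummettVariety.{u}) (X := ℕ) (Y := ℕ)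
    fun i => if i < n then var _ i else opZero F
  let G := Substructure.closure godelLang (Set.range fun i => ρ (var _ i))
  have hρG := hom_mem ρ G fun i => Substructure.subset_closure ⟨i, rfl⟩
  have hfix : ∀ a ∈ t.1, ρ a = a := fun a ha => hN a ρ fun i hi => by
    rw [hρ, if_pos (hi.trans_le (Finset.le_sup (f := N) (Multiset.mem_toFinset.2 ha)))]
  have : Finite G := finite_closure (model_freeAlg ℕ) <| by
    refine (((Set.finite_lt_nat n).image (var _)).insert (opZero F)).subset ?_
    rintro _ ⟨i, rfl⟩
    by_cases hi : i < n
    · exact .inr ⟨i, hi, by simp [hρ, hi]⟩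
    · exact .inl (by simp [hρ, hi])
  have hG : GodelDummettVariety G :=
    varietyOf_of_injective (model_freeAlg ℕ) G.subtype.toHom Subtype.val_injective
  let ι := {a // a ∈ t.1.toFinset}
  have : Nonempty ι := by
    obtain ⟨a, ha⟩ := Multiset.exists_mem_of_ne_zero t.2
    exact ⟨⟨a, Multiset.mem_toFinset.2 ha⟩⟩
  have hmem (k : ι) : k.1 ∈ t.1 := Multiset.mem_toFinset.1 k.2
  have : Nontrivial G := nontrivial_of_hom G.subtype.toHom (zero_ne_one_freeAlg ℕ)
  -- The power `ι → G` is countable, so sending the `i`-th variable to `e i` maps `F` onto it.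
  obtain ⟨e, he⟩ := exists_surjective_nat (ι → G)
  choose q hq using fun k : ι => exists_hom (V := GodelDummettVariety.{u}) (X := ℕ) (Y := ℕ)
    fun i => (e i k).1
  let Q : F →[godelLang] ι → G := piHom fun k =>
    (q k).codRestrict G (hom_mem _ G fun i => by rw [hq]; exact (e i k).2)
  have hQ : Function.Surjective Q := fun p => by
    obtain ⟨i, rfl⟩ := he p
    exact ⟨var _ i, funext fun k => Subtype.ext (hq k i)⟩
  obtain ⟨j, hj⟩ := (isProjective_of_finite (P := ι → G) (varietyOf_pi fun _ => hG)).2 F (ι → G)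
    (model_freeAlg ℕ) (varietyOf_pi fun _ => hG) (Hom.id _ _) Q hQ
  let p : ι → G := fun k => ⟨k.1, by rw [← hfix _ (hmem k)]; exact hρG _⟩
  refine posetType_of_isLeast ⟨j p, fun a ha => ?_⟩ fun s => ?_
  · refine ⟨(G.subtype.toHom.comp (evalHom _ ⟨a, Multiset.mem_toFinset.2 ha⟩)).comp Q, ?_⟩
    have : Q (j p) = p := DFunLike.congr_fun hj p
    simp only [Hom.comp_apply, this]
    rfl
  -- Composing the substitutions `σ k` with `ρ` sends `s` to `p` in the power, and `j` then sends
  -- `p` to the least solution.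
  · choose σ hσ using fun k : ι => s.2 k (hmem k)
    refine ⟨j.comp (piHom fun k => (ρ.comp (σ k)).codRestrict G fun _ => hρG _), ?_⟩
    refine congrArg j (funext fun k => Subtype.ext ?_)
    change ρ (σ k s.1) = k.1
    rw [hσ, hfix _ (hmem k)]

theorem algProblemType_eq_unitary (H : AlgProblem GodelDummettVariety.{u}) :
    algProblemType _ H = .unitary := by
  have hfin (k) : Finite (H.E k) := by
    obtain ⟨a, ha⟩ := H.oneGenerated k
    have := finite_closure (H.exact k).1 (Set.finite_singleton a)
    rw [ha] at this
    exact Finite.of_equiv _ (Substructure.topEquiv (L := godelLang)).toEquiv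
  have hnontrivial (k) : Nontrivial (H.E k) := by
    obtain ⟨-, X, -, S, -, ⟨f⟩⟩ := H.exact k
    exact nontrivial_of_hom (S.subtype.toHom.comp f.toHom) (zero_ne_one_freeAlg X)
  have : Nontrivial (∀ k, H.E k) := Pi.nontrivial_at ⟨0, H.one_le⟩
  have hP : IsProjective _ (∀ k, H.E k) :=
    isProjective_of_finite (varietyOf_pi fun k => (H.exact k).1)
  have hFG : Structure.FG godelLang (∀ k, H.E k) :=
    Structure.fg_def.2 (Substructure.fg_def.2 ⟨Set.univ, Set.finite_univ,
      Substructure.closure_univ⟩)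
  -- The factorization required of a solution `s` is literally the inequality `H.h ≤ s`.
  exact posetType_of_isLeast ⟨_, hFG, hP, H.h, Hom.id _ _, rfl⟩ fun s => s.witness

instance : Nonempty (SymProblem GodelDummettVariety.{u}) :=
  ⟨{var _ 0}, Multiset.singleton_ne_zero _⟩

instance : Nonempty (AlgProblem GodelDummettVariety.{u}) := by
  let F := FreeAlg GodelDummettVariety.{u} PUnit.{u + 1}
  have hgen : Substructure.closure godelLang {var GodelDummettVariety.{u} PUnit.unit.{u + 1}} =
      ⊤ := by
    rw [← closure_var]
    congr 1
    ext a
    exact ⟨fun h => ⟨_, h.symm⟩, fun ⟨_, h⟩ => h.symm⟩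
  exact ⟨
    { m := 1
      one_le := le_rfl
      E := fun _ => F
      exact := fun _ => ⟨model_freeAlg _, PUnit, inferInstance, ⊤,
        Substructure.fg_def.2 ⟨_, Set.finite_singleton _, hgen⟩, ⟨Substructure.topEquiv.symm⟩⟩
      oneGenerated := fun _ => ⟨_, hgen⟩
      h := piHom fun _ => Hom.id _ _
      surjective := fun _ => Function.surjective_id }⟩

end EGen

theorem mainTheorem9 :
    (EGen.HasSymbolicType EGen.GodelDummettVariety.{u} EGen.GenType.unitary ∧
      EGen.HasAlgebraicType EGen.GodelDummettVariety.{u} EGen.GenType.unitary) ∧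
    (EGen.HasSymbolicType EGen.GodelAlgebras.{u} EGen.GenType.unitary ∧
      EGen.HasAlgebraicType EGen.GodelAlgebras.{u} EGen.GenType.unitary) := by
  rw [EGen.godelAlgebras_eq, and_self]
  exact ⟨EGen.isLeast_range_unitary EGen.symProblemType_eq_unitary,
    EGen.isLeast_range_unitary EGen.algProblemType_eq_unitary⟩
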